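/- **Theorem (one-posterior-sampling with generalized PTR).** Let $\mathcal X\subset\mathbb R^d$ and $\mathcal Y\subset\mathbb R$ be bounded, $\|\mathcal X\|=\sup_{x\in\mathcal X}\|x\|$, $\|\mathcal Y\|=\sup_{y\in\mathcal Y}|y|$. A data set $Z=(X,Y)$ consists of $n$ points $(x_i,y_i)\in\mathcal X\times\mathcal Y$ (the $x_i$ are the rows of $X$); two data sets are neighbors if they differ in at most one of the $n$ points. A randomized algorithm $M$ is $(\epsilon,\delta)$-DP if $\Pr[M(Z)\in S]\le e^{\epsilon}\Pr[M(Z')\in S]+\delta$ for all neighbors $Z,Z'$ and measurable $S$; it is $(\epsilon,\delta)$ data-dependent DP for the data set $Z$ if this inequality and the one with $Z,Z'$ exchanged hold for all neighbors $Z'$ of $Z$ and all measurable $S$. Fix $\lambda,\gamma>0$, $\epsilon,\delta,\hat\epsilon\ge 0$ and $\hat\delta>0$. Let $M_{\lambda,\gamma}(Z)$ be a sample from the probability density on $\mathbb R^d$ proportional to $$\exp\!\big(-\gamma\,(\tfrac12\|Y-X\theta\|^2+\tfrac12\lambda\|\theta\|^2)\big).$$ Let $\lambda_{\min}(Z)$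 be the smallest eigenvalue of $X^TX$, $\theta^*_\lambda=(X^TX+\lambda I)^{-1}X^TY$, and $L(Z)=\|\mathcal X\|(\|\mathcal X\|\|\theta^*_\lambda\|+\|\mathcal Y\|)$. Let $R$ be an $(\epsilon,\delta/2)$-DP mechanism with outputs in $\mathbb R^3$ (the private release of $\lambda_{\min},\|\theta^*_\lambda\|,L$), and let $\epsilon^P:\mathbb R^3\to\mathbb R$ be measurable (the sanitized data-dependent DP bound). The algorithm *OPS with PTR* draws $r\sim R(Z)$ and publishes it; if $\epsilon^P(r)<\hat\epsilon$ it publishes $\theta\sim M_{\lambda,\gamma}(Z)$, otherwise it publishes $\perp$. 1. Let $e:\mathbb R^3\to\mathbb R$ be any function such that, with $\epsilon_\phi(Z):=e(\lambda_{\min}(Z),\|\theta_\lambda^*\|,L(Z))$, $M_{\lambda,\gamma}$ is $(\epsilon_\phi(Z),\hat\delta)$ data-dependent DP for every data set $Z$. If for every $Z$, with probability at least $1-\delta/2$ over $r\sim R(Z)$, $\epsilon_\phi(Z)\le\epsilon^P(r)$, then OPS with PTR is $(\epsilon+\hat\epsilon,\delta+\hat\delta)$-DP. 2. In particular, let $c=(\underline\lambda,\overline\theta,\overline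 L):\mathbb R^3\to\mathbb R^3$ be a measurable map such that for every $Z$, with probability at least $1-\delta/2$ over $r\sim R(Z)$, the three bounds $\underline\lambda(r)\le\lambda_{\min}(Z)$, $\|\theta^*_\lambda\|\le\overline\theta(r)$ and $L(Z)\le\overline L(r)$ hold. Then OPS with PTR with the explicit test $$\epsilon^P(r)=a^2+at+\tfrac b2\big(1+(a+t)^2\big),\qquad a=2\overline L(r)\sqrt{\gamma/\kappa},\quad b=\|\mathcal X\|^2/\kappa,\quad t=\sqrt{2\log(3/\hat\delta)},$$ $$\kappa=\lambda+\max(\underline\lambda(r)-\|\mathcal X\|^2,0),$$ (where $t:=0$ if $\hat\delta>3$) is $(\epsilon+\hat\epsilon,\delta+\hat\delta)$-DP. -/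

import Mathlib

open MeasureTheory
open scoped Matrix ENNReal

noncomputable section

namespace OPSPTR

/-- Data sets of size `n`: each data point is a pair of a covariate in `𝒳 ⊆ ℝ^d` and a response
in `𝒴 ⊆ ℝ`. -/
abbrev Dataset {d : ℕ} (𝒳 : Set (EuclideanSpace ℝ (Fin d))) (𝒴 : Set ℝ) (n : ℕ) : Type :=
  Fin n → 𝒳 × 𝒴

open Classical in
/-- Two data sets of the same size are neighbors if they differ in at most one data point. -/
def Neighbor {A : Type*} {n : ℕ} (z z' : Fin n → A) : Prop :=
  hammingDist z z' ≤ 1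

/-- `(ε, δ)`-differential privacy of a randomized algorithm; `M z` is the law of its output
on the data set `z`. -/
structure IsDP {A Ω : Type*} {n : ℕ} [MeasurableSpace Ω]
    (M : (Fin n → A) → Measure Ω) (ε δ : ℝ) : Prop where
  isProbabilityMeasure : ∀ z, IsProbabilityMeasure (M z)
  bound : ∀ z z', Neighbor z z' → ∀ S : Set Ω, MeasurableSet S →
    M z S ≤ ENNReal.ofReal (Real.exp ε) * M z' S + ENNReal.ofReal δ

/-- `M` satisfies `(ε, δ)` data-dependent differential privacy for the data set `z`. -/
def IsDataDependentDP {A Ω : Type*} {n : ℕ} [MeasurableSpace Ω]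
    (M : (Fin n → A) → Measure Ω) (z : Fin n → A) (ε δ : ℝ) : Prop :=
  ∀ z', Neighbor z z' → ∀ S : Set Ω, MeasurableSet S →
    M z S ≤ ENNReal.ofReal (Real.exp ε) * M z' S + ENNReal.ofReal δ ∧
    M z' S ≤ ENNReal.ofReal (Real.exp ε) * M z S + ENNReal.ofReal δ

/-- `sup_{x ∈ A} ‖x‖`. -/
def radius {E : Type*} [Norm E] (A : Set E) : ℝ :=
  sSup ((fun x => ‖x‖) '' A)

section Regression

variable {d n : ℕ} {𝒳 : Set (EuclideanSpace ℝ (Fin d))} {𝒴 : Set ℝ}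

/-- The `n × d` matrix `X` whose rows are the covariates. -/
def design (z : Dataset 𝒳 𝒴 n) : Matrix (Fin n) (Fin d) ℝ :=
  Matrix.of fun i j => ((z i).1 : EuclideanSpace ℝ (Fin d)) j

/-- The vector `Y` of responses. -/
def response (z : Dataset 𝒳 𝒴 n) : Fin n → ℝ :=
  fun i => ((z i).2 : ℝ)

/-- The smallest eigenvalue of `Xᵀ X`. -/
def lambdaMin (z : Dataset 𝒳 𝒴 n) : ℝ :=
  sInf (spectrum ℝ ((design z)ᵀ * design z))

/-- The ridge regression solution `(Xᵀ X + lam I)⁻¹ Xᵀ Y`. -/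
def ridge (lam : ℝ) (z : Dataset 𝒳 𝒴 n) : EuclideanSpace ℝ (Fin d) :=
  WithLp.toLp 2
    (((design z)ᵀ * design z + lam • (1 : Matrix (Fin d) (Fin d) ℝ))⁻¹ *ᵥ
      ((design z)ᵀ *ᵥ response z))

/-- The local Lipschitz constant `‖𝒳‖ (‖𝒳‖ ‖θ‖ + ‖𝒴‖)` at the ridge solution `θ`. -/
def localLipschitz (lam : ℝ) (z : Dataset 𝒳 𝒴 n) : ℝ :=
  radius 𝒳 * (radius 𝒳 * ‖ridge lam z‖ + radius 𝒴)

/-- The regression loss `½ ‖Y - X θ‖²`. -/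
def loss (z : Dataset 𝒳 𝒴 n) (θ : EuclideanSpace ℝ (Fin d)) : ℝ :=
  (1 / 2) * ∑ i, (response z i - (design z *ᵥ θ.ofLp) i) ^ 2

/-- One posterior sample: the probability measure on `ℝ^d` with Lebesgue density proportional to
`exp (-gam (½ ‖Y - X θ‖² + ½ lam ‖θ‖²))`. -/
def posterior (lam gam : ℝ) (z : Dataset 𝒳 𝒴 n) : Measure (EuclideanSpace ℝ (Fin d)) :=
  (volume : Measure (EuclideanSpace ℝ (Fin d))).tilted
    fun θ => -gam * (loss z θ + (1 / 2) * lam * ‖θ‖ ^ 2)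

open Classical in
/-- One posterior sampling with generalized propose-test-release, for the proposal `(lam, gam)`.
Draw `r` from the release mechanism `R` (sanitized values of `λ_min`, `‖θ‖` and `L`), publish it,
and compute the sanitized privacy bound `epsP r`. If it is smaller than the budget `epsHat`, publish
a sample from the posterior; otherwise publish `⊥`, represented by `Sum.inr ()`. -/
def opsPTR (lam gam : ℝ) (R : Dataset 𝒳 𝒴 n → Measure (ℝ × ℝ × ℝ)) (epsP : ℝ × ℝ × ℝ → ℝ)
    (epsHat : ℝ) (z : Dataset 𝒳 𝒴 n) :
    Measure ((ℝ × ℝ × ℝ) × (EuclideanSpace ℝ (Fin d) ⊕ Unit)) :=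
  (R z).bind fun r =>
    if epsP r < epsHat then (posterior lam gam z).map fun θ => (r, Sum.inl θ)
    else Measure.dirac (r, Sum.inr ())

end Regression

/-- An explicit privacy bound for posterior sampling, as a function of the smallest eigenvalue
`l` and the local Lipschitz constant `L`; here `B = ‖𝒳‖` and `δ` is the failure probability. With
`κ = lam + max (l - B², 0)`, `a = 2 L √(gam / κ)`, `b = B² / κ` and `t = √(2 log (3 / δ))` it is
`a² + a t + (b / 2) (1 + (a + t)²)`. -/
def explicitBound (lam gam B δ l L : ℝ) : ℝ :=
  let κ := lam + max (l - B ^ 2) 0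
  let a := 2 * L * Real.sqrt (gam / κ)
  let b := B ^ 2 / κ
  let t := Real.sqrt (2 * Real.log (3 / δ))
  a ^ 2 + a * t + b / 2 * (1 + (a + t) ^ 2)

end OPSPTR

end

/-!
Completing the square, the posterior is the Gaussian with mean the ridge solution and precision
`gam (Xᵀ X + lam I)`. For neighboring data sets the two precisions are rank-one perturbations of
the precision of the common `n - 1` points, which is at least `gam κ` with
`κ = lam + max (λ_min - ‖𝒳‖²) 0`, and the normal equations express the precision applied to the
difference of the means through two residuals, so its norm is at most `2 gam L`. The privacy loss
is therefore a linear Gaussian variable with deviation at most `a` plus two rank-one quadratics and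
a log-determinant, both of order `b`; three Gaussian tails of mass `δhat / 3` control it.
Under propose-test-release, the release and the posterior sample compose, and the event that
the sanitized bound is too optimistic costs another `δ / 2`.
-/

noncomputable section

namespace OPSPTR

section ApproxLE

variable {Ω Ω' : Type*} [MeasurableSpace Ω] [MeasurableSpace Ω']

/-- `μ` is dominated by `c ν` up to an additive error `δ` on every measurable set: one half of
`(ε, δ)`-indistinguishability, with `c = exp ε`. -/
def ApproxLE (c δ : ℝ≥0∞) (μ ν : Measure Ω) : Prop :=
  ∀ S, MeasurableSet S → μ S ≤ c * ν S + δ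

/-- `μ` and `ν` dominate each other up to the factor `c` and the additive error `δ`; for
`c = exp ε` this is `(ε, δ)`-indistinguishability. -/
def Indistinguishable (c δ : ℝ≥0∞) (μ ν : Measure Ω) : Prop :=
  ApproxLE c δ μ ν ∧ ApproxLE c δ ν μ

variable {μ ν : Measure Ω} {c c' δ δ' η : ℝ≥0∞}

lemma ApproxLE.refl (hc : 1 ≤ c) (δ : ℝ≥0∞) (μ : Measure Ω) : ApproxLE c δ μ μ :=
  fun _ _ => (le_mul_of_one_le_left' hc).trans le_self_add

lemma ApproxLE.mono (h : ApproxLE c δ μ ν) (hc : c ≤ c') : ApproxLE c' δ μ ν :=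
  fun S hS => (h S hS).trans (by gcongr)

lemma approxLE_of_one_le [IsProbabilityMeasure μ] (hδ : 1 ≤ δ) : ApproxLE c δ μ ν :=
  fun _ _ => prob_le_one.trans (hδ.trans le_add_self)

lemma ApproxLE.map (h : ApproxLE c δ μ ν) {f : Ω → Ω'} (hf : Measurable f) :
    ApproxLE c δ (μ.map f) (ν.map f) := fun S hS => by
  simpa only [Measure.map_apply hf hS] using h _ (hf hS)

lemma lintegral_eq_setLIntegral_Ioc_meas_le {f : Ω → ℝ≥0∞} (hf : Measurable f)
    (hf1 : ∀ x, f x ≤ 1) :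
    ∫⁻ x, f x ∂μ = ∫⁻ t in Set.Ioc (0 : ℝ) 1, μ {x | t ≤ (f x).toReal} := by
  have hfin (x : Ω) : f x ≠ ∞ := ((hf1 x).trans_lt ENNReal.one_lt_top).ne
  have htail : ∫⁻ t in Set.Ioi (1 : ℝ), μ {x | t ≤ (f x).toReal} = 0 := by
    refine (setLIntegral_congr_fun (g := fun _ => 0) measurableSet_Ioi fun t ht => ?_).trans
      lintegral_zero
    have hempty : {x | t ≤ (f x).toReal} = ∅ :=
      Set.eq_empty_of_forall_notMem fun x hx =>
        ht.not_ge (hx.trans (ENNReal.toReal_mono ENNReal.one_ne_top (hf1 x)))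
    simp only [hempty, measure_empty]
  calc ∫⁻ x, f x ∂μ = ∫⁻ x, ENNReal.ofReal (f x).toReal ∂μ := by
        simp only [ENNReal.ofReal_toReal (hfin _)]
    _ = ∫⁻ t in Set.Ioi (0 : ℝ), μ {x | t ≤ (f x).toReal} :=
        lintegral_eq_lintegral_meas_le μ (ae_of_all _ fun _ => ENNReal.toReal_nonneg)
          hf.ennreal_toReal.aemeasurable
    _ = ∫⁻ t in Set.Ioc (0 : ℝ) 1, μ {x | t ≤ (f x).toReal} := by
        rw [← Set.Ioc_union_Ioi_eq_Ioi zero_le_one, lintegral_union measurableSet_Ioi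
          (Set.Ioc_disjoint_Ioi le_rfl), htail, add_zero]

lemma ApproxLE.lintegral_le (h : ApproxLE c δ μ ν) {f : Ω → ℝ≥0∞} (hf : Measurable f)
    (hf1 : ∀ x, f x ≤ 1) : ∫⁻ x, f x ∂μ ≤ c * ∫⁻ x, f x ∂ν + δ := by
  have hmeas : Measurable fun t : ℝ => ν {x | t ≤ (f x).toReal} :=
    Antitone.measurable fun _ _ hst => measure_mono fun _ hx => hst.trans hx
  rw [lintegral_eq_setLIntegral_Ioc_meas_le hf hf1, lintegral_eq_setLIntegral_Ioc_meas_le hf hf1]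
  calc ∫⁻ t in Set.Ioc (0 : ℝ) 1, μ {x | t ≤ (f x).toReal}
      ≤ ∫⁻ t in Set.Ioc (0 : ℝ) 1, (c * ν {x | t ≤ (f x).toReal} + δ) :=
        lintegral_mono fun t => h _ (measurableSet_le measurable_const hf.ennreal_toReal)
    _ = c * (∫⁻ t in Set.Ioc (0 : ℝ) 1, ν {x | t ≤ (f x).toReal}) + δ := by
        rw [lintegral_add_right _ measurable_const, lintegral_const_mul _ hmeas]
        simp

-- Capping `c' * K' r S` at `1` makes it a legitimate test function for `ApproxLE.lintegral_le`.
lemma ApproxLE.bind [IsProbabilityMeasure μ] (h : ApproxLE c δ μ ν) {K K' : Ω → Measure Ω'}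
    (hK : Measurable K) (hK' : Measurable K') (hprob : ∀ r, IsProbabilityMeasure (K r))
    {E : Set Ω} (hE : MeasurableSet E) (hμE : μ Eᶜ ≤ η)
    (hKK' : ∀ r ∈ E, ApproxLE c' δ' (K r) (K' r)) :
    ApproxLE (c * c') (δ + (η + δ')) (μ.bind K) (ν.bind K') := by
  intro S hS
  have hK'S : Measurable fun r => K' r S := (Measure.measurable_coe hS).comp hK'
  have hcap : Measurable fun r => min 1 (c' * K' r S) := measurable_const.min (hK'S.const_mul _)
  have hpointwise (r : Ω) : K r S ≤ min 1 (c' * K' r S) + (Eᶜ.indicator 1 r + δ') := by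
    by_cases hr : r ∈ E
    · rw [Set.indicator_of_notMem (Set.notMem_compl_iff.2 hr), zero_add, min_add]
      exact le_min (prob_le_one.trans le_self_add) (hKK' r hr S hS)
    · rw [Set.indicator_of_mem hr, Pi.one_apply]
      exact prob_le_one.trans (le_self_add.trans le_add_self)
  rw [Measure.bind_apply hS hK.aemeasurable, Measure.bind_apply hS hK'.aemeasurable]
  calc ∫⁻ r, K r S ∂μ
      ≤ ∫⁻ r, (min 1 (c' * K' r S) + (Eᶜ.indicator 1 r + δ')) ∂μ := lintegral_mono hpointwise
    _ = ∫⁻ r, min 1 (c' * K' r S) ∂μ + (μ Eᶜ + δ') := by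
        rw [lintegral_add_left hcap, lintegral_add_right _ measurable_const,
          lintegral_indicator_one hE.compl, lintegral_const, measure_univ, mul_one]
    _ ≤ (c * ∫⁻ r, c' * K' r S ∂ν + δ) + (η + δ') := by
        refine add_le_add ((h.lintegral_le hcap fun r => min_le_left _ _).trans ?_) ?_
        · gcongr
          exact min_le_right _ _
        · gcongr
    _ = c * c' * ∫⁻ r, K' r S ∂ν + (δ + (η + δ')) := by
        rw [lintegral_const_mul _ hK'S, mul_assoc, add_assoc]

lemma approxLE_tilted [NeZero μ] {f g : Ω → ℝ} (hg : Measurable g)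
    (hf_int : Integrable (fun x => Real.exp (f x)) μ)
    (hg_int : Integrable (fun x => Real.exp (g x)) μ) {ε : ℝ} {B : Set Ω} (hB : MeasurableSet B)
    (hμB : μ.tilted f B ≤ δ)
    (hratio : ∀ x ∉ B, f x + Real.log (∫ y, Real.exp (g y) ∂μ)
      ≤ ε + (g x + Real.log (∫ y, Real.exp (f y) ∂μ))) :
    ApproxLE (ENNReal.ofReal (Real.exp ε)) δ (μ.tilted f) (μ.tilted g) := by
  intro S hS
  have hdensity (x : Ω) (hx : x ∉ B) : Real.exp (f x) / ∫ y, Real.exp (f y) ∂μ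
      ≤ Real.exp ε * (Real.exp (g x) / ∫ y, Real.exp (g y) ∂μ) := by
    have h := hratio x hx
    rw [← Real.exp_log (integral_exp_pos hf_int), ← Real.exp_log (integral_exp_pos hg_int),
      ← Real.exp_sub, ← Real.exp_sub, ← Real.exp_add]
    exact Real.exp_le_exp.2 (by linarith)
  calc μ.tilted f S ≤ μ.tilted f (S \ B) + μ.tilted f B :=
        (measure_mono (Set.subset_sdiff_union S B)).trans (measure_union_le _ _)
    _ ≤ ENNReal.ofReal (Real.exp ε) * μ.tilted g (S \ B) + δ := by
        refine add_le_add ?_ hμB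
        rw [tilted_apply' _ _ (hS.diff hB), tilted_apply' _ _ (hS.diff hB),
          ← lintegral_const_mul _ (by fun_prop)]
        refine setLIntegral_mono (by fun_prop) fun x hx => ?_
        rw [← ENNReal.ofReal_mul (Real.exp_pos _).le]
        exact ENNReal.ofReal_le_ofReal (hdensity x hx.2)
    _ ≤ ENNReal.ofReal (Real.exp ε) * μ.tilted g S + δ := by
        gcongr
        exact Set.sdiff_subset

end ApproxLE

section ProposeTestRelease

variable {A Ω Θ : Type*} {n : ℕ} [MeasurableSpace Ω] [MeasurableSpace Θ]

open Classical in
/-- The law of the output of propose-test-release once the release `r` has been drawn: `r` together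
with a sample from `P` if the proposed bound `epsP r` passes the test, and `r` together with the
refusal `Sum.inr ()` otherwise. -/
def testedRelease (epsP : Ω → ℝ) (epsHat : ℝ) (P : Measure Θ) (r : Ω) :
    Measure (Ω × (Θ ⊕ Unit)) :=
  if epsP r < epsHat then P.map fun θ => (r, Sum.inl θ) else Measure.dirac (r, Sum.inr ())

/-- Propose-test-release with release mechanism `R` and proposed mechanism `M`, for an arbitrary
type of data points. -/
def proposeTestRelease (R : (Fin n → A) → Measure Ω) (M : (Fin n → A) → Measure Θ)
    (epsP : Ω → ℝ) (epsHat : ℝ) (z : Fin n → A) : Measure (Ω × (Θ ⊕ Unit)) :=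
  (R z).bind (testedRelease epsP epsHat (M z))

lemma measurable_mk_inl (r : Ω) :
    Measurable fun θ : Θ => ((r, Sum.inl θ) : Ω × (Θ ⊕ Unit)) :=
  measurable_const.prodMk measurable_inl

variable {epsP : Ω → ℝ} {epsHat : ℝ}

lemma measurable_testedRelease (hepsP : Measurable epsP) (P : Measure Θ) [SFinite P] :
    Measurable (testedRelease epsP epsHat P) := by
  refine Measurable.ite (measurableSet_lt hepsP measurable_const) ?_
    (Measure.measurable_dirac.comp (measurable_id.prodMk measurable_const))
  have hmap (r : Ω) : P.map (fun θ => ((r, Sum.inl θ) : Ω × (Θ ⊕ Unit)))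
      = (P.map Sum.inl).map (Prod.mk r) :=
    (Measure.map_map measurable_prodMk_left measurable_inl).symm
  simp only [hmap]
  exact Measurable.map_prodMk_left

lemma isProbabilityMeasure_testedRelease (P : Measure Θ) [IsProbabilityMeasure P] (r : Ω) :
    IsProbabilityMeasure (testedRelease epsP epsHat P r) := by
  unfold testedRelease
  split_ifs
  · exact Measure.isProbabilityMeasure_map (measurable_mk_inl r).aemeasurable
  · infer_instance

lemma approxLE_testedRelease (hepsHat : 0 ≤ epsHat) {P P' : Measure Θ} {η : ℝ} {δ : ℝ≥0∞}
    (hPP' : ApproxLE (ENNReal.ofReal (Real.exp η)) δ P P') {r : Ω} (hr : η ≤ epsP r) :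
    ApproxLE (ENNReal.ofReal (Real.exp epsHat)) δ (testedRelease epsP epsHat P r)
      (testedRelease epsP epsHat P' r) := by
  unfold testedRelease
  split_ifs with htest
  · refine (hPP'.map (measurable_mk_inl r)).mono ?_
    gcongr
    exact hr.trans htest.le
  · exact ApproxLE.refl (by simpa using hepsHat) δ _

lemma measure_compl_le_of_one_sub_le {μ : Measure Ω} [IsProbabilityMeasure μ] {E : Set Ω}
    (hE : MeasurableSet E) {δ : ℝ} (h : ENNReal.ofReal (1 - δ) ≤ μ E) :
    μ Eᶜ ≤ ENNReal.ofReal δ := by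
  rw [prob_compl_eq_one_sub hE, tsub_le_iff_right]
  calc (1 : ℝ≥0∞) = ENNReal.ofReal (δ + (1 - δ)) := by simp
    _ ≤ ENNReal.ofReal δ + ENNReal.ofReal (1 - δ) := ENNReal.ofReal_add_le
    _ ≤ ENNReal.ofReal δ + μ E := by gcongr

theorem proposeTestRelease_isDP {R : (Fin n → A) → Measure Ω} {M : (Fin n → A) → Measure Θ}
    {ε δ δHat : ℝ} (hδ : 0 ≤ δ) (hepsHat : 0 ≤ epsHat) (hδHat : 0 ≤ δHat)
    (hR : IsDP R ε (δ / 2)) (hM : ∀ z, IsProbabilityMeasure (M z)) {η : (Fin n → A) → ℝ}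
    (hη : ∀ z, IsDataDependentDP M z (η z) δHat) (hepsP : Measurable epsP)
    (hconf : ∀ z, ENNReal.ofReal (1 - δ / 2) ≤ R z {r | η z ≤ epsP r}) :
    IsDP (proposeTestRelease R M epsP epsHat) (ε + epsHat) (δ + δHat) where
  isProbabilityMeasure z := by
    have := hR.isProbabilityMeasure z
    exact isProbabilityMeasure_bind (measurable_testedRelease hepsP (M z)).aemeasurable
      (ae_of_all _ (isProbabilityMeasure_testedRelease (M z)))
  bound z z' hzz' := by
    have := hR.isProbabilityMeasure z
    have hgood : MeasurableSet {r | η z ≤ epsP r} := measurableSet_le measurable_const hepsP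
    have hrelease : ApproxLE (ENNReal.ofReal (Real.exp ε)) (ENNReal.ofReal (δ / 2)) (R z) (R z') :=
      hR.bound z z' hzz'
    have hsample : ApproxLE (ENNReal.ofReal (Real.exp (η z))) (ENNReal.ofReal δHat) (M z) (M z') :=
      fun S hS => (hη z z' hzz' S hS).1
    have hout := hrelease.bind (measurable_testedRelease hepsP (M z))
      (measurable_testedRelease hepsP (M z')) (isProbabilityMeasure_testedRelease (M z))
      hgood (measure_compl_le_of_one_sub_le hgood (hconf z))
      fun r hr => approxLE_testedRelease hepsHat hsample hr
    rw [← ENNReal.ofReal_mul (Real.exp_pos ε).le, ← Real.exp_add, ← add_assoc,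
      ← ENNReal.ofReal_add (by positivity) (by positivity), add_halves,
      ← ENNReal.ofReal_add hδ hδHat] at hout
    exact hout

end ProposeTestRelease

section Loewner

open InnerProductSpace
open scoped RealInnerProductSpace

variable {V : Type*} [NormedAddCommGroup V] [InnerProductSpace ℝ V] {κ a b : ℝ}
  {T : V →L[ℝ] V}

lemma smul_one_le_iff :
    κ • 1 ≤ T ↔ (T : V →ₗ[ℝ] V).IsSymmetric ∧ ∀ u, κ * ‖u‖ ^ 2 ≤ ⟪T u, u⟫ := by
  have hsymm : (κ • 1 : V →L[ℝ] V).toLinearMap.IsSymmetric := fun u v => by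
    simp [real_inner_smul_left, real_inner_smul_right]
  have hsymm_sub : (T - κ • 1 : V →L[ℝ] V).toLinearMap.IsSymmetric
      ↔ (T : V →ₗ[ℝ] V).IsSymmetric :=
    ⟨fun h => by simpa using h.add hsymm, fun h => h.sub hsymm⟩
  rw [ContinuousLinearMap.le_def, ContinuousLinearMap.isPositive_iff, hsymm_sub]
  simp [inner_sub_left, real_inner_smul_left]

lemma inner_rankOne_self (x u : V) : ⟪rankOne ℝ x x u, u⟫ = ⟪x, u⟫ ^ 2 := by
  rw [rankOne_apply, real_inner_smul_left, sq]

lemma le_add_rankOne_self (T : V →L[ℝ] V) (x : V) : T ≤ T + rankOne ℝ x x := by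
  rw [ContinuousLinearMap.le_def, add_sub_cancel_left]
  exact isPositive_rankOne_self x

lemma inner_add_rankOne_self (T : V →L[ℝ] V) (x u : V) :
    ⟪(T + rankOne ℝ x x) u, u⟫ = ⟪T u, u⟫ + ⟪x, u⟫ ^ 2 := by
  rw [add_apply, inner_add_left, inner_rankOne_self]

lemma mul_norm_le_norm_apply (hT : κ • 1 ≤ T) (u : V) : κ * ‖u‖ ≤ ‖T u‖ := by
  rcases (norm_nonneg u).eq_or_lt with hu | hu
  · simp [← hu]
  · refine le_of_mul_le_mul_right ?_ hu
    calc κ * ‖u‖ * ‖u‖ = κ * ‖u‖ ^ 2 := by ring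
      _ ≤ ⟪T u, u⟫ := (smul_one_le_iff.1 hT).2 u
      _ ≤ ‖T u‖ * ‖u‖ := real_inner_le_norm _ _

lemma inner_apply_self_le (hκ : 0 < κ) (hT : κ • 1 ≤ T) (u : V) :
    ⟪T u, u⟫ ≤ ‖T u‖ ^ 2 / κ := by
  rw [le_div_iff₀ hκ]
  calc ⟪T u, u⟫ * κ ≤ ‖T u‖ * ‖u‖ * κ := by gcongr; exact real_inner_le_norm _ _
    _ = ‖T u‖ * (κ * ‖u‖) := by ring
    _ ≤ ‖T u‖ * ‖T u‖ := by gcongr; exact mul_norm_le_norm_apply hT u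
    _ = ‖T u‖ ^ 2 := by ring

lemma inner_apply_self_nonneg (hκ : 0 ≤ κ) (hT : κ • 1 ≤ T) (u : V) : 0 ≤ ⟪T u, u⟫ :=
  (by positivity : 0 ≤ κ * ‖u‖ ^ 2).trans ((smul_one_le_iff.1 hT).2 u)

lemma surjective_of_smul_one_le [FiniteDimensional ℝ V] (hκ : 0 < κ) (hT : κ • 1 ≤ T) :
    Function.Surjective T := by
  suffices hinj : Function.Injective (T : V →ₗ[ℝ] V) from LinearMap.injective_iff_surjective.1 hinj
  refine (injective_iff_map_eq_zero _).2 fun u hu => norm_le_zero_iff.1 ?_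
  refine nonpos_of_mul_nonpos_right ?_ hκ
  exact (mul_norm_le_norm_apply hT u).trans_eq (norm_eq_zero.2 hu)

lemma inner_apply_sub_self (hT : (T : V →ₗ[ℝ] V).IsSymmetric) (u w : V) :
    ⟪T (u - w), u - w⟫ = ⟪T u, u⟫ - 2 * ⟪T w, u⟫ + ⟪T w, w⟫ := by
  have hcross : ⟪T u, w⟫ = ⟪T w, u⟫ := (hT u w).trans (real_inner_comm _ _)
  rw [map_sub, inner_sub_left, inner_sub_right, inner_sub_right, hcross]
  ring

lemma sq_inner_le_of_abs_inner_le {x u : V} {s : ℝ} (hb : 0 ≤ b) (h : |⟪x, u⟫| ≤ √b * s) :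
    ⟪x, u⟫ ^ 2 ≤ b * s ^ 2 := by
  calc ⟪x, u⟫ ^ 2 ≤ (√b * s) ^ 2 := sq_le_sq' (neg_le_of_abs_le h) (le_of_abs_le h)
    _ = b * s ^ 2 := by rw [mul_pow, Real.sq_sqrt hb]

lemma abs_inner_le_of_norm_apply_le (hκ : 0 < κ) (hT : κ • 1 ≤ T) {x w : V} (hb : 0 ≤ b)
    (hx : ‖x‖ ^ 2 ≤ b * κ) (ha : 0 ≤ a) (hw : ‖T w‖ ^ 2 ≤ a ^ 2 * κ) : |⟪x, w⟫| ≤ √b * a := by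
  have hx_norm : ‖x‖ ≤ √b * √κ := by
    rw [← Real.sqrt_mul hb]
    exact Real.le_sqrt_of_sq_le hx
  have hTw_norm : ‖T w‖ ≤ a * √κ := by
    rw [← abs_of_nonneg ha, ← Real.sqrt_sq_eq_abs, ← Real.sqrt_mul (sq_nonneg a)]
    exact Real.le_sqrt_of_sq_le hw
  have hsqrt : √κ * √κ = κ := Real.mul_self_sqrt hκ.le
  have hw_norm : √κ * ‖w‖ ≤ a := by
    refine le_of_mul_le_mul_right ?_ (Real.sqrt_pos.2 hκ)
    calc √κ * ‖w‖ * √κ = κ * ‖w‖ := by rw [mul_right_comm, hsqrt]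
      _ ≤ a * √κ := (mul_norm_le_norm_apply hT w).trans hTw_norm
  calc |⟪x, w⟫| ≤ ‖x‖ * ‖w‖ := abs_real_inner_le_norm x w
    _ ≤ √b * √κ * ‖w‖ := by gcongr
    _ = √b * (√κ * ‖w‖) := mul_assoc _ _ _
    _ ≤ √b * a := by gcongr

end Loewner

section Gaussian

open InnerProductSpace ProbabilityTheory
open scoped RealInnerProductSpace

variable {V : Type*} [NormedAddCommGroup V] [InnerProductSpace ℝ V] [FiniteDimensional ℝ V]
  [MeasurableSpace V] [BorelSpace V] {κ a b t : ℝ} {S T T' : V →L[ℝ] V}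

lemma integrable_exp_inner_sub_quadratic (hκ : 0 < κ) (hT : κ • 1 ≤ T) (c : V) :
    Integrable fun u : V => Real.exp (⟪c, u⟫ - 1 / 2 * ⟪T u, u⟫) := by
  have hdom := (GaussianFourier.integrable_cexp_neg_mul_sq_norm_add (V := V)
    (b := ((κ / 2 : ℝ) : ℂ)) (by simpa using hκ) 1 c).norm
  refine hdom.mono' (by fun_prop) (ae_of_all _ fun u => ?_)
  have hre : (-((κ / 2 : ℝ) : ℂ) * (‖u‖ : ℂ) ^ 2 + 1 * ((⟪c, u⟫ : ℝ) : ℂ)).re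
      = -(κ / 2) * ‖u‖ ^ 2 + ⟪c, u⟫ := by
    norm_cast
    ring
  rw [Complex.norm_exp, Real.norm_eq_abs, Real.abs_exp]
  refine Real.exp_le_exp.2 (le_trans ?_ hre.ge)
  linarith [(smul_one_le_iff.1 hT).2 u]

/-- The Gaussian integral `∫ exp (-⟪T u, u⟫ / 2) du`, the normalizing constant of the Gaussian
densities with precision operator `T`. -/
def gaussianMass (T : V →L[ℝ] V) : ℝ := ∫ u : V, Real.exp (-(1 / 2) * ⟪T u, u⟫)

lemma integrable_exp_neg_quadratic (hκ : 0 < κ) (hT : κ • 1 ≤ T) :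
    Integrable fun u : V => Real.exp (-(1 / 2) * ⟪T u, u⟫) := by
  simpa using integrable_exp_inner_sub_quadratic hκ hT 0

lemma gaussianMass_pos (hκ : 0 < κ) (hT : κ • 1 ≤ T) : 0 < gaussianMass T :=
  integral_exp_pos (integrable_exp_neg_quadratic hκ hT)

lemma integral_exp_inner_sub_quadratic (hT : (T : V →ₗ[ℝ] V).IsSymmetric) (w : V) :
    ∫ u : V, Real.exp (⟪T w, u⟫ - 1 / 2 * ⟪T u, u⟫)
      = Real.exp (1 / 2 * ⟪T w, w⟫) * gaussianMass T := by
  have hsquare (u : V) : Real.exp (⟪T w, u⟫ - 1 / 2 * ⟪T u, u⟫)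
      = Real.exp (1 / 2 * ⟪T w, w⟫) * Real.exp (-(1 / 2) * ⟪T (u - w), u - w⟫) := by
    rw [← Real.exp_add, inner_apply_sub_self hT]
    ring_nf
  simp_rw [hsquare]
  rw [integral_const_mul,
    integral_sub_right_eq_self (fun u : V => Real.exp (-(1 / 2) * ⟪T u, u⟫)) w, gaussianMass]

lemma integral_exp_inner_sub_quadratic_le (hκ : 0 < κ) (hT : κ • 1 ≤ T) (c : V) :
    ∫ u : V, Real.exp (⟪c, u⟫ - 1 / 2 * ⟪T u, u⟫)
      ≤ Real.exp (‖c‖ ^ 2 / κ / 2) * gaussianMass T := by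
  obtain ⟨w, rfl⟩ := surjective_of_smul_one_le hκ hT c
  rw [integral_exp_inner_sub_quadratic (smul_one_le_iff.1 hT).1]
  gcongr
  · exact (gaussianMass_pos hκ hT).le
  · linarith [inner_apply_self_le hκ hT w]

lemma gaussianMass_eq_abs_det_mul {A : V →ₗ[ℝ] V} (hA : LinearMap.det A ≠ 0)
    (hquad : ∀ u, ⟪T (A u), A u⟫ = ⟪T' u, u⟫) :
    gaussianMass T = |LinearMap.det A| * gaussianMass T' := by
  have hA_meas : Measurable A := A.continuous_of_finiteDimensional.measurable
  calc gaussianMass T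
      = |LinearMap.det A| * (|(LinearMap.det A)⁻¹| * ∫ v : V, Real.exp (-(1 / 2) * ⟪T v, v⟫)) := by
        rw [abs_inv, mul_inv_cancel_left₀ (abs_ne_zero.2 hA), gaussianMass]
    _ = |LinearMap.det A| * ∫ v : V, Real.exp (-(1 / 2) * ⟪T v, v⟫) ∂(volume.map A) := by
        rw [Measure.map_linearMap_addHaar_eq_smul_addHaar volume hA, integral_smul_measure,
          ENNReal.toReal_ofReal (abs_nonneg _), smul_eq_mul]
    _ = |LinearMap.det A| * gaussianMass T' := by
        rw [integral_map hA_meas.aemeasurable (Continuous.aestronglyMeasurable (by fun_prop))]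
        simp only [hquad, gaussianMass]

/- The transvection `u ↦ u + α ⟪x, u⟫ w` has determinant `1 + α q`, and it carries `T` to
`T + x xᵀ` as soon as `2 α + α² q = 1`, that is `1 + α q = √(1 + q)`. -/
lemma gaussianMass_eq_sqrt_mul (hT : (T : V →ₗ[ℝ] V).IsSymmetric) {x w : V} (hw : T w = x)
    (hq : 0 ≤ ⟪x, w⟫) :
    gaussianMass T = √(1 + ⟪x, w⟫) * gaussianMass (T + rankOne ℝ x x) := by
  set q := ⟪x, w⟫ with hq_def
  have hsqrt : √(1 + q) ^ 2 = 1 + q := Real.sq_sqrt (by positivity)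
  have hsqrt_pos : 0 < √(1 + q) := Real.sqrt_pos.2 (by positivity)
  set α := (1 + √(1 + q))⁻¹
  have hα : α * (1 + √(1 + q)) = 1 := inv_mul_cancel₀ (by positivity)
  have hαq : 1 + α * q = √(1 + q) := by linear_combination (√(1 + q) - 1) * hα - α * hsqrt
  let A : V →ₗ[ℝ] V := LinearMap.transvection (innerSL ℝ x : V →ₗ[ℝ] ℝ) (α • w)
  have hA (u : V) : A u = u + (α * ⟪x, u⟫) • w := by
    simp [A, LinearMap.transvection.apply, smul_smul, mul_comm]
  have hdet : LinearMap.det A = √(1 + q) := by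
    simp [A, LinearMap.transvection.det, hαq, ← hq_def]
  rw [← abs_of_pos hsqrt_pos, ← hdet]
  refine gaussianMass_eq_abs_det_mul (hdet ▸ hsqrt_pos.ne') fun u => ?_
  have hcross : ⟪T u, w⟫ = ⟪x, u⟫ := by rw [← hw]; exact (hT u w).trans (real_inner_comm _ _)
  rw [inner_add_rankOne_self, hA, map_add, map_smul, hw]
  simp only [inner_add_left, inner_add_right, real_inner_smul_left, real_inner_smul_right, hcross]
  linear_combination (α * ⟪x, u⟫ ^ 2) * hαq + ⟪x, u⟫ ^ 2 * hα

lemma log_gaussianMass_add_rankOne_le (hκ : 0 < κ) (hT : κ • 1 ≤ T) (x : V) :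
    Real.log (gaussianMass (T + rankOne ℝ x x)) ≤ Real.log (gaussianMass T) := by
  have hTx := hT.trans (le_add_rankOne_self T x)
  refine Real.log_le_log (gaussianMass_pos hκ hTx) (integral_mono
    (integrable_exp_neg_quadratic hκ hTx) (integrable_exp_neg_quadratic hκ hT) fun u => ?_)
  refine Real.exp_le_exp.2 ?_
  rw [inner_add_rankOne_self]
  linarith [sq_nonneg ⟪x, u⟫]

lemma log_gaussianMass_le_add_rankOne (hκ : 0 < κ) (hT : κ • 1 ≤ T) {x : V}
    (hx : ‖x‖ ^ 2 ≤ b * κ) :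
    Real.log (gaussianMass T) ≤ b / 2 + Real.log (gaussianMass (T + rankOne ℝ x x)) := by
  obtain ⟨w, hw⟩ := surjective_of_smul_one_le hκ hT x
  have hq : 0 ≤ ⟪x, w⟫ := hw ▸ inner_apply_self_nonneg hκ.le hT w
  have hqb : ⟪x, w⟫ ≤ b := (hw ▸ inner_apply_self_le hκ hT w).trans ((div_le_iff₀ hκ).2 hx)
  have hmass := gaussianMass_pos hκ (hT.trans (le_add_rankOne_self T x))
  rw [gaussianMass_eq_sqrt_mul (smul_one_le_iff.1 hT).1 hw hq,
    Real.log_mul (Real.sqrt_pos.2 (by positivity)).ne' hmass.ne', Real.log_sqrt (by positivity)]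
  linarith [Real.log_le_sub_one_of_pos (by positivity : 0 < 1 + ⟪x, w⟫)]

/-- The Gaussian measure on `V` with mean `m` and precision (inverse covariance) operator `T`, as
an exponential tilt of Lebesgue measure. -/
def precisionGaussian (T : V →L[ℝ] V) (m : V) : Measure V :=
  (volume : Measure V).tilted fun θ => -(1 / 2) * ⟪T (θ - m), θ - m⟫

lemma integrable_exp_neg_quadratic_sub (hκ : 0 < κ) (hT : κ • 1 ≤ T) (m : V) :
    Integrable fun θ : V => Real.exp (-(1 / 2) * ⟪T (θ - m), θ - m⟫) :=
  (integrable_exp_neg_quadratic hκ hT).comp_sub_right m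

lemma integral_exp_neg_quadratic_sub (T : V →L[ℝ] V) (m : V) :
    ∫ θ : V, Real.exp (-(1 / 2) * ⟪T (θ - m), θ - m⟫) = gaussianMass T :=
  integral_sub_right_eq_self (fun u : V => Real.exp (-(1 / 2) * ⟪T u, u⟫)) m

lemma isProbabilityMeasure_precisionGaussian (hκ : 0 < κ) (hT : κ • 1 ≤ T) (m : V) :
    IsProbabilityMeasure (precisionGaussian T m) :=
  isProbabilityMeasure_tilted (integrable_exp_neg_quadratic_sub hκ hT m)

lemma hasSubgaussianMGF_inner_precisionGaussian (hκ : 0 < κ) (hT : κ • 1 ≤ T) (m c : V) :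
    HasSubgaussianMGF (fun θ => ⟪c, θ - m⟫) (‖c‖ ^ 2 / κ).toNNReal (precisionGaussian T m) := by
  have hexp (s : ℝ) (θ : V) : -(1 / 2) * ⟪T (θ - m), θ - m⟫ + s * ⟪c, θ - m⟫
      = ⟪s • c, θ - m⟫ - 1 / 2 * ⟪T (θ - m), θ - m⟫ := by
    rw [real_inner_smul_left]
    ring
  constructor
  · intro s
    rw [precisionGaussian, integrable_tilted_iff (integrable_exp_neg_quadratic_sub hκ hT m)]
    simp only [smul_eq_mul, ← Real.exp_add, hexp]
    exact (integrable_exp_inner_sub_quadratic hκ hT (s • c)).comp_sub_right m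
  · intro s
    rw [mgf, precisionGaussian, integral_exp_tilted, integral_exp_neg_quadratic_sub,
      div_le_iff₀ (gaussianMass_pos hκ hT)]
    simp only [Pi.add_apply, hexp]
    rw [integral_sub_right_eq_self fun u : V => Real.exp (⟪s • c, u⟫ - 1 / 2 * ⟪T u, u⟫)]
    have hvar : ‖s • c‖ ^ 2 / κ / 2 = (‖c‖ ^ 2 / κ).toNNReal * s ^ 2 / 2 := by
      rw [Real.coe_toNNReal _ (by positivity), norm_smul, mul_pow, Real.norm_eq_abs, sq_abs]
      ring
    exact hvar ▸ integral_exp_inner_sub_quadratic_le hκ hT (s • c)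

lemma precisionGaussian_inner_tail_le (hκ : 0 < κ) (hT : κ • 1 ≤ T) (m : V) {c : V} {σ : ℝ}
    (hσ : 0 ≤ σ) (hc : ‖c‖ ^ 2 ≤ σ ^ 2 * κ) (ht : 0 ≤ t) :
    precisionGaussian T m {θ | σ * t < ⟪c, θ - m⟫} ≤ ENNReal.ofReal (Real.exp (-t ^ 2 / 2)) := by
  rcases eq_or_ne c 0 with rfl | hc0
  · simp [(mul_nonneg hσ ht).not_gt]
  have := isProbabilityMeasure_precisionGaussian hκ hT m
  have htail := (hasSubgaussianMGF_inner_precisionGaussian hκ hT m c).measure_ge_le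
    (mul_nonneg hσ ht)
  rw [measureReal_def, ← ENNReal.le_ofReal_iff_toReal_le (measure_ne_top _ _) (by positivity),
    Real.coe_toNNReal _ (by positivity)] at htail
  have hsub : {θ | σ * t < ⟪c, θ - m⟫} ⊆ {θ | σ * t ≤ ⟪c, θ - m⟫} := fun θ hθ =>
    (show σ * t < ⟪c, θ - m⟫ from hθ).le
  refine (measure_mono hsub).trans
    (htail.trans (ENNReal.ofReal_le_ofReal (Real.exp_le_exp.2 ?_)))
  have hvar_pos : 0 < ‖c‖ ^ 2 / κ := by positivity
  have hvar_le : ‖c‖ ^ 2 / κ ≤ σ ^ 2 := (div_le_iff₀ hκ).2 hc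
  rw [div_le_div_iff₀ (by positivity) two_pos]
  nlinarith [sq_nonneg t]

lemma precisionGaussian_compl_inner_le (hκ : 0 < κ) (hT : κ • 1 ≤ T) (m : V) {g x : V} {β : ℝ}
    (ha : 0 ≤ a) (hg : ‖g‖ ^ 2 ≤ a ^ 2 * κ) (hβ : 0 ≤ β) (hx : ‖x‖ ^ 2 ≤ β ^ 2 * κ)
    (ht : 0 ≤ t) :
    precisionGaussian T m {θ | ⟪g, θ - m⟫ ≤ a * t ∧ |⟪x, θ - m⟫| ≤ β * t}ᶜ
      ≤ ENNReal.ofReal (3 * Real.exp (-t ^ 2 / 2)) := by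
  have hsub : {θ | ⟪g, θ - m⟫ ≤ a * t ∧ |⟪x, θ - m⟫| ≤ β * t}ᶜ ⊆ {θ | a * t < ⟪g, θ - m⟫}
      ∪ ({θ | β * t < ⟪x, θ - m⟫} ∪ {θ | β * t < ⟪-x, θ - m⟫}) := fun θ hθ => by
    by_contra hgood
    simp only [Set.mem_union, Set.mem_ofPred_eq, not_or, not_lt, inner_neg_left] at hgood
    exact hθ ⟨hgood.1, abs_le.2 ⟨by linarith [hgood.2.2], hgood.2.1⟩⟩
  have hunion : ENNReal.ofReal (3 * Real.exp (-t ^ 2 / 2))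
      = ENNReal.ofReal (Real.exp (-t ^ 2 / 2)) + (ENNReal.ofReal (Real.exp (-t ^ 2 / 2))
        + ENNReal.ofReal (Real.exp (-t ^ 2 / 2))) := by
    rw [ENNReal.ofReal_mul zero_le_three, ENNReal.ofReal_ofNat]
    ring
  rw [hunion]
  refine (measure_mono hsub).trans ((measure_union_le _ _).trans (add_le_add
    (precisionGaussian_inner_tail_le hκ hT m ha hg ht) ((measure_union_le _ _).trans (add_le_add
      (precisionGaussian_inner_tail_le hκ hT m hβ hx ht)
      (precisionGaussian_inner_tail_le hκ hT m hβ (by rwa [norm_neg]) ht)))))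

lemma approxLE_precisionGaussian (hκ : 0 < κ) (hT : κ • 1 ≤ T) (hT' : κ • 1 ≤ T') {m m' g x : V}
    {ε β : ℝ} (ha : 0 ≤ a) (hg : ‖g‖ ^ 2 ≤ a ^ 2 * κ) (hβ : 0 ≤ β) (hx : ‖x‖ ^ 2 ≤ β ^ 2 * κ)
    (ht : 0 ≤ t)
    (hloss : ∀ u, ⟪g, u⟫ ≤ a * t → |⟪x, u⟫| ≤ β * t →
      -(1 / 2) * ⟪T u, u⟫ + Real.log (gaussianMass T')
        ≤ ε + (-(1 / 2) * ⟪T' (u - (m' - m)), u - (m' - m)⟫ + Real.log (gaussianMass T))) :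
    ApproxLE (ENNReal.ofReal (Real.exp ε)) (ENNReal.ofReal (3 * Real.exp (-t ^ 2 / 2)))
      (precisionGaussian T m) (precisionGaussian T' m') := by
  have hgood : MeasurableSet {θ | ⟪g, θ - m⟫ ≤ a * t ∧ |⟪x, θ - m⟫| ≤ β * t} :=
    .inter (s₁ := {θ | ⟪g, θ - m⟫ ≤ a * t}) (s₂ := {θ | |⟪x, θ - m⟫| ≤ β * t})
      (measurableSet_le (by fun_prop) measurable_const)
      (measurableSet_le (by fun_prop) measurable_const)
  refine approxLE_tilted (by fun_prop) (integrable_exp_neg_quadratic_sub hκ hT m)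
    (integrable_exp_neg_quadratic_sub hκ hT' m') hgood.compl
    (precisionGaussian_compl_inner_le hκ hT m ha hg hβ hx ht) fun θ hθ => ?_
  obtain ⟨hgθ, hxθ⟩ := Set.notMem_compl_iff.1 hθ
  simpa only [integral_exp_neg_quadratic_sub, sub_sub_sub_cancel_right] using
    hloss (θ - m) hgθ hxθ

lemma approxLE_precisionGaussian_of_norm_target_le (hκ : 0 < κ) (hS : κ • 1 ≤ S) {x x' m m' : V}
    (hb : 0 ≤ b) (hx : ‖x‖ ^ 2 ≤ b * κ) (hx' : ‖x'‖ ^ 2 ≤ b * κ) (ha : 0 ≤ a)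
    (hshift : ‖(S + rankOne ℝ x' x') (m' - m)‖ ^ 2 ≤ a ^ 2 * κ) (ht : 0 ≤ t) :
    ApproxLE (ENNReal.ofReal (Real.exp (a ^ 2 / 2 + a * t + b / 2 * (1 + t ^ 2))))
      (ENNReal.ofReal (3 * Real.exp (-t ^ 2 / 2)))
      (precisionGaussian (S + rankOne ℝ x x) m) (precisionGaussian (S + rankOne ℝ x' x') m') := by
  set T' := S + rankOne ℝ x' x'
  have hT : κ • 1 ≤ S + rankOne ℝ x x := hS.trans (le_add_rankOne_self S x)
  have hT' : κ • 1 ≤ T' := hS.trans (le_add_rankOne_self S x')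
  refine approxLE_precisionGaussian hκ hT hT' (g := -T' (m' - m)) (x := x') ha
    (by rwa [norm_neg]) (Real.sqrt_nonneg b) (by rwa [Real.sq_sqrt hb]) ht fun u hg hx'u => ?_
  have hmass : Real.log (gaussianMass T') ≤ b / 2 + Real.log (gaussianMass (S + rankOne ℝ x x)) :=
    (log_gaussianMass_add_rankOne_le hκ hS x').trans (log_gaussianMass_le_add_rankOne hκ hS hx)
  have hmean : ⟪T' (m' - m), m' - m⟫ ≤ a ^ 2 :=
    (inner_apply_self_le hκ hT' _).trans ((div_le_iff₀ hκ).2 hshift)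
  have hquad : ⟪x', u⟫ ^ 2 ≤ b * t ^ 2 := sq_inner_le_of_abs_inner_le hb hx'u
  rw [inner_neg_left] at hg
  rw [inner_apply_sub_self (smul_one_le_iff.1 hT').1 u]
  have hTu : ⟪T' u, u⟫ = ⟪S u, u⟫ + ⟪x', u⟫ ^ 2 := inner_add_rankOne_self S x' u
  rw [hTu, inner_add_rankOne_self]
  linarith [sq_nonneg ⟪x, u⟫]

lemma approxLE_precisionGaussian_of_norm_source_le (hκ : 0 < κ) (hS : κ • 1 ≤ S) {x x' m m' : V}
    (hb : 0 ≤ b) (hx : ‖x‖ ^ 2 ≤ b * κ) (hx' : ‖x'‖ ^ 2 ≤ b * κ) (ha : 0 ≤ a)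
    (hshift : ‖(S + rankOne ℝ x x) (m' - m)‖ ^ 2 ≤ a ^ 2 * κ) (ht : 0 ≤ t) :
    ApproxLE (ENNReal.ofReal (Real.exp (a ^ 2 / 2 + a * t + b / 2 * (1 + (a + t) ^ 2))))
      (ENNReal.ofReal (3 * Real.exp (-t ^ 2 / 2)))
      (precisionGaussian (S + rankOne ℝ x x) m) (precisionGaussian (S + rankOne ℝ x' x') m') := by
  set T := S + rankOne ℝ x x with hT_def
  set w := m' - m with hw_def
  have hT : κ • 1 ≤ T := hS.trans (le_add_rankOne_self S x)
  have hT' : κ • 1 ≤ S + rankOne ℝ x' x' := hS.trans (le_add_rankOne_self S x')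
  refine approxLE_precisionGaussian hκ hT hT' (g := -T w) (x := x') ha
    (by rwa [norm_neg]) (Real.sqrt_nonneg b) (by rwa [Real.sq_sqrt hb]) ht fun u hg hx'u => ?_
  have hmass : Real.log (gaussianMass (S + rankOne ℝ x' x')) ≤ b / 2 + Real.log (gaussianMass T) :=
    (log_gaussianMass_add_rankOne_le hκ hS x').trans (log_gaussianMass_le_add_rankOne hκ hS hx)
  have hx'w : |⟪x', w⟫| ≤ √b * a := abs_inner_le_of_norm_apply_le hκ hT hb hx' ha hshift
  have hquad : ⟪x', u - w⟫ ^ 2 ≤ b * (a + t) ^ 2 := by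
    refine sq_inner_le_of_abs_inner_le hb ?_
    rw [inner_sub_right]
    linarith [abs_sub ⟪x', u⟫ ⟪x', w⟫]
  have hmean : ⟪T w, w⟫ ≤ a ^ 2 := (inner_apply_self_le hκ hT w).trans ((div_le_iff₀ hκ).2 hshift)
  have hsub : ⟪S (u - w), u - w⟫ + ⟪x, u - w⟫ ^ 2 = ⟪T u, u⟫ - 2 * ⟪T w, u⟫ + ⟪T w, w⟫ := by
    rw [← inner_add_rankOne_self, ← hT_def, inner_apply_sub_self (smul_one_le_iff.1 hT).1]
  rw [inner_neg_left] at hg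
  rw [← hw_def, inner_add_rankOne_self S x']
  linarith [sq_nonneg ⟪x, u - w⟫]

lemma indistinguishable_precisionGaussian (hκ : 0 < κ) (hS : κ • 1 ≤ S) {x x' m m' : V}
    (hb : 0 ≤ b) (hx : ‖x‖ ^ 2 ≤ b * κ) (hx' : ‖x'‖ ^ 2 ≤ b * κ) (ha : 0 ≤ a)
    (hshift : ‖(S + rankOne ℝ x' x') (m' - m)‖ ^ 2 ≤ a ^ 2 * κ) (ht : 0 ≤ t) :
    Indistinguishable
      (ENNReal.ofReal (Real.exp (a ^ 2 + a * t + b / 2 * (1 + (a + t) ^ 2))))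
      (ENNReal.ofReal (3 * Real.exp (-t ^ 2 / 2)))
      (precisionGaussian (S + rankOne ℝ x x) m) (precisionGaussian (S + rankOne ℝ x' x') m') := by
  have hshift_neg : ‖(S + rankOne ℝ x' x') (m - m')‖ ^ 2 ≤ a ^ 2 * κ := by
    rwa [← neg_sub, map_neg, norm_neg]
  constructor
  · refine (approxLE_precisionGaussian_of_norm_target_le hκ hS hb hx hx' ha hshift ht).mono
      (ENNReal.ofReal_le_ofReal (Real.exp_le_exp.2 (add_le_add ?_ ?_)))
    · linarith [sq_nonneg a]
    · gcongr
      linarith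
  · refine (approxLE_precisionGaussian_of_norm_source_le hκ hS hb hx' hx ha hshift_neg ht).mono
      (ENNReal.ofReal_le_ofReal (Real.exp_le_exp.2 ?_))
    linarith [sq_nonneg a]

end Gaussian

section RegularizedGram

open InnerProductSpace
open scoped RealInnerProductSpace

variable {ι V : Type*} [NormedAddCommGroup V] [InnerProductSpace ℝ V] {lam l B : ℝ} {i : ι}
  {s : Finset ι} {x x' : ι → V} {y y' : ι → ℝ}

/-- The regularized Gram operator `∑ i ∈ s, xᵢ xᵢᵀ + lam I` of a family of vectors. -/
def regularizedGram (lam : ℝ) (s : Finset ι) (x : ι → V) : V →L[ℝ] V :=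
  ∑ i ∈ s, rankOne ℝ (x i) (x i) + lam • 1

lemma regularizedGram_apply (lam : ℝ) (s : Finset ι) (x : ι → V) (u : V) :
    regularizedGram lam s x u = ∑ i ∈ s, ⟪x i, u⟫ • x i + lam • u := by
  simp [regularizedGram]

lemma regularizedGram_congr (lam : ℝ) (hx : Set.EqOn x x' s) :
    regularizedGram lam s x = regularizedGram lam s x' := by
  rw [regularizedGram, regularizedGram]
  congr 1
  exact Finset.sum_congr rfl fun j hj => by rw [hx hj]

lemma inner_regularizedGram_self (lam : ℝ) (s : Finset ι) (x : ι → V) (u : V) :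
    ⟪regularizedGram lam s x u, u⟫ = ∑ i ∈ s, ⟪x i, u⟫ ^ 2 + lam * ‖u‖ ^ 2 := by
  simp only [regularizedGram_apply, inner_add_left, sum_inner, real_inner_smul_left,
    real_inner_self_eq_norm_sq, sq]

lemma isSymmetric_regularizedGram (lam : ℝ) (s : Finset ι) (x : ι → V) :
    (regularizedGram lam s x : V →ₗ[ℝ] V).IsSymmetric := fun u v => by
  simp only [ContinuousLinearMap.coe_coe, regularizedGram_apply, inner_add_left, inner_add_right,
    sum_inner, inner_sum, real_inner_smul_left, real_inner_smul_right]
  congr 1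
  refine Finset.sum_congr rfl fun i _ => ?_
  rw [real_inner_comm (x i) u, mul_comm]

lemma regularizedGram_erase_add_rankOne [DecidableEq ι] (lam : ℝ) (hi : i ∈ s) (x : ι → V) :
    regularizedGram lam (s.erase i) x + rankOne ℝ (x i) (x i) = regularizedGram lam s x := by
  rw [regularizedGram, regularizedGram, add_right_comm, Finset.sum_erase_add _ _ hi]

lemma smul_one_le_regularizedGram (hl : ∀ u, l * ‖u‖ ^ 2 ≤ ∑ i ∈ s, ⟪x i, u⟫ ^ 2) :
    (lam + l) • 1 ≤ regularizedGram lam s x :=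
  smul_one_le_iff.2 ⟨isSymmetric_regularizedGram lam s x, fun u => by
    rw [inner_regularizedGram_self, add_mul, add_comm]
    gcongr
    exact hl u⟩

lemma smul_one_le_regularizedGram_erase [DecidableEq ι] (hi : i ∈ s) (hB : ‖x i‖ ≤ B)
    (hl : ∀ u, l * ‖u‖ ^ 2 ≤ ∑ j ∈ s, ⟪x j, u⟫ ^ 2) :
    (lam + max (l - B ^ 2) 0) • 1 ≤ regularizedGram lam (s.erase i) x := by
  refine smul_one_le_regularizedGram fun u => ?_
  rw [max_mul_of_nonneg _ _ (sq_nonneg ‖u‖), zero_mul]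
  refine max_le ?_ (Finset.sum_nonneg fun j _ => sq_nonneg _)
  have herased : ⟪x i, u⟫ ^ 2 ≤ B ^ 2 * ‖u‖ ^ 2 := by
    rw [← mul_pow, ← sq_abs]
    gcongr
    exact (abs_real_inner_le_norm _ _).trans (by gcongr)
  linarith [hl u, Finset.sum_erase_add s (fun j => ⟪x j, u⟫ ^ 2) hi]

lemma sum_sq_residual_add_eq {m : V} (hm : regularizedGram lam s x m = ∑ i ∈ s, y i • x i) (θ : V) :
    ∑ i ∈ s, (y i - ⟪x i, θ⟫) ^ 2 + lam * ‖θ‖ ^ 2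
      = ⟪regularizedGram lam s x (θ - m), θ - m⟫
        + (∑ i ∈ s, y i ^ 2 - ⟪regularizedGram lam s x m, m⟫) := by
  have hexpand : ∑ i ∈ s, (y i - ⟪x i, θ⟫) ^ 2
      = ∑ i ∈ s, y i ^ 2 - 2 * ⟪∑ i ∈ s, y i • x i, θ⟫ + ∑ i ∈ s, ⟪x i, θ⟫ ^ 2 := by
    simp only [sum_inner, real_inner_smul_left, Finset.mul_sum, ← Finset.sum_sub_distrib,
      ← Finset.sum_add_distrib]
    exact Finset.sum_congr rfl fun i _ => by ring
  rw [inner_apply_sub_self (isSymmetric_regularizedGram lam s x), inner_regularizedGram_self,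
    hexpand, hm]
  ring

lemma regularizedGram_sub_eq_of_eqOn_erase [DecidableEq ι] (hi : i ∈ s)
    (hx : Set.EqOn x x' (s.erase i)) (hy : Set.EqOn y y' (s.erase i)) {m m' : V}
    (hm : regularizedGram lam s x m = ∑ j ∈ s, y j • x j)
    (hm' : regularizedGram lam s x' m' = ∑ j ∈ s, y' j • x' j) :
    regularizedGram lam s x' (m' - m)
      = (y' i - ⟪x' i, m⟫) • x' i - (y i - ⟪x i, m⟫) • x i := by
  have hsum : ∑ j ∈ s.erase i, y' j • x' j = ∑ j ∈ s.erase i, y j • x j :=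
    Finset.sum_congr rfl fun j hj => by rw [hx hj, hy hj]
  rw [← regularizedGram_erase_add_rankOne lam hi, ← Finset.sum_erase_add _ _ hi] at hm
  rw [map_sub, hm', ← regularizedGram_erase_add_rankOne lam hi, ← regularizedGram_congr lam hx,
    ← Finset.sum_erase_add _ _ hi, hsum, eq_sub_of_add_eq hm.symm]
  simp only [add_apply, rankOne_apply, sub_smul]
  abel

end RegularizedGram

section ExplicitBound

open InnerProductSpace

variable {lam gam B δ l l' L L' : ℝ}

lemma explicitBound_nonneg (hlam : 0 < lam) (hL : 0 ≤ L) : 0 ≤ explicitBound lam gam B δ l L := by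
  have hκ : 0 < lam + max (l - B ^ 2) 0 := by positivity
  unfold explicitBound
  positivity

lemma explicitBound_mono (hlam : 0 < lam) (hgam : 0 ≤ gam) (hl : l' ≤ l) (hL : 0 ≤ L)
    (hLL' : L ≤ L') : explicitBound lam gam B δ l L ≤ explicitBound lam gam B δ l' L' := by
  have hκ : 0 < lam + max (l' - B ^ 2) 0 := by positivity
  have hL' : 0 ≤ 2 * L' := by linarith
  unfold explicitBound
  dsimp only
  gcongr

lemma measurable_explicitBound {Ω : Type*} [MeasurableSpace Ω] (lam gam B δ : ℝ) {l L : Ω → ℝ}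
    (hl : Measurable l) (hL : Measurable L) :
    Measurable fun r => explicitBound lam gam B δ (l r) (L r) := by
  unfold explicitBound
  fun_prop

lemma three_mul_exp_neg_sqrt_sq (hδ : 0 < δ) (hδ3 : δ ≤ 3) :
    3 * Real.exp (-√(2 * Real.log (3 / δ)) ^ 2 / 2) = δ := by
  have hlog : 0 ≤ Real.log (3 / δ) := Real.log_nonneg ((one_le_div hδ).2 hδ3)
  have hexponent : -√(2 * Real.log (3 / δ)) ^ 2 / 2 = -Real.log (3 / δ) := by
    rw [Real.sq_sqrt (by positivity)]
    ring
  rw [hexponent, Real.exp_neg, Real.exp_log (by positivity)]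
  field_simp

variable {V : Type*} [NormedAddCommGroup V] [InnerProductSpace ℝ V] {S : V →L[ℝ] V}

lemma smul_one_le_smul {κ : ℝ} (hgam : 0 ≤ gam) (hS : κ • 1 ≤ S) : (gam * κ) • 1 ≤ gam • S := by
  rw [mul_smul, ContinuousLinearMap.le_def, ← smul_sub]
  exact hS.smul_of_nonneg hgam

lemma smul_add_rankOne_self (hgam : 0 ≤ gam) (S : V →L[ℝ] V) (x : V) :
    gam • (S + rankOne ℝ x x) = gam • S + rankOne ℝ (√gam • x) (√gam • x) := by
  ext u
  simp [smul_smul, Real.mul_self_sqrt hgam]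

lemma norm_sqrt_smul_sq_le {κ : ℝ} (hκ : 0 < κ) (hgam : 0 ≤ gam) {v : V} (hv : ‖v‖ ≤ B) :
    ‖√gam • v‖ ^ 2 ≤ B ^ 2 / κ * (gam * κ) := by
  rw [norm_smul, mul_pow, Real.norm_eq_abs, sq_abs, Real.sq_sqrt hgam, mul_left_comm,
    div_mul_cancel₀ _ hκ.ne']
  gcongr

lemma norm_smul_sq_le {κ : ℝ} (hκ : 0 < κ) (hgam : 0 ≤ gam) {v : V} (hv : ‖v‖ ≤ L) :
    ‖gam • v‖ ^ 2 ≤ (L * √(gam / κ)) ^ 2 * (gam * κ) := by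
  have hscale : (L * √(gam / κ)) ^ 2 * (gam * κ) = gam ^ 2 * L ^ 2 := by
    rw [mul_pow, Real.sq_sqrt (by positivity)]
    field_simp
  rw [hscale, norm_smul, mul_pow, Real.norm_eq_abs, sq_abs]
  gcongr

variable [FiniteDimensional ℝ V] [MeasurableSpace V] [BorelSpace V]

theorem indistinguishable_precisionGaussian_explicitBound (hlam : 0 < lam) (hgam : 0 < gam)
    (hδ : 0 < δ) (hδ3 : δ ≤ 3) (hS : (lam + max (l - B ^ 2) 0) • 1 ≤ S) {x x' m m' : V}
    (hx : ‖x‖ ≤ B) (hx' : ‖x'‖ ≤ B) (hshift : ‖(S + rankOne ℝ x' x') (m' - m)‖ ≤ 2 * L) :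
    Indistinguishable (ENNReal.ofReal (Real.exp (explicitBound lam gam B δ l L)))
      (ENNReal.ofReal δ) (precisionGaussian (gam • (S + rankOne ℝ x x)) m)
      (precisionGaussian (gam • (S + rankOne ℝ x' x')) m') := by
  have hκ : 0 < lam + max (l - B ^ 2) 0 := by positivity
  have h2L : 0 ≤ 2 * L := (norm_nonneg _).trans hshift
  have hshift_gam := norm_smul_sq_le hκ hgam.le hshift
  rw [← smul_apply, smul_add_rankOne_self hgam.le] at hshift_gam
  have hindist := indistinguishable_precisionGaussian (mul_pos hgam hκ)
    (smul_one_le_smul hgam.le hS) (by positivity) (norm_sqrt_smul_sq_le hκ hgam.le hx)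
    (norm_sqrt_smul_sq_le hκ hgam.le hx') (by positivity) hshift_gam
    (Real.sqrt_nonneg (2 * Real.log (3 / δ)))
  rw [three_mul_exp_neg_sqrt_sq hδ hδ3] at hindist
  simpa only [explicitBound, smul_add_rankOne_self hgam.le] using hindist

end ExplicitBound

section Posterior

open InnerProductSpace
open scoped RealInnerProductSpace

lemma Neighbor.exists_forall_ne_eq {A : Type*} {n : ℕ} {z z' : Fin n → A} (h : Neighbor z z')
    (hne : z ≠ z') : ∃ i, ∀ j, j ≠ i → z j = z' j := by
  classical
  obtain ⟨i, hi⟩ := Function.ne_iff.1 hne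
  refine ⟨i, fun j hj => ?_⟩
  by_contra hzj
  exact hj (Finset.card_le_one.1 h j (by simpa using hzj) i (by simpa using hi))

lemma radius_nonneg {E : Type*} [SeminormedAddCommGroup E] (A : Set E) : 0 ≤ radius A :=
  Real.sSup_nonneg (Set.forall_mem_image.2 fun x _ => norm_nonneg x)

lemma norm_le_radius {E : Type*} [SeminormedAddCommGroup E] {A : Set E}
    (hA : Bornology.IsBounded A) {x : E} (hx : x ∈ A) : ‖x‖ ≤ radius A := by
  obtain ⟨C, hC⟩ := hA.exists_norm_le
  exact le_csSup ⟨C, Set.forall_mem_image.2 hC⟩ (Set.mem_image_of_mem _ hx)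

lemma norm_residual_smul_le {V : Type*} [NormedAddCommGroup V] [InnerProductSpace ℝ V] {x : V}
    {y B C : ℝ} (hx : ‖x‖ ≤ B) (hy : ‖y‖ ≤ C) (θ : V) :
    ‖(y - ⟪x, θ⟫) • x‖ ≤ B * (B * ‖θ‖ + C) := by
  have hB : 0 ≤ B := (norm_nonneg x).trans hx
  have hinner : ‖⟪x, θ⟫‖ ≤ B * ‖θ‖ := (norm_inner_le_norm x θ).trans (by gcongr)
  rw [norm_smul, mul_comm]
  gcongr
  linarith [norm_sub_le y ⟪x, θ⟫]

lemma tilted_add_const {Ω : Type*} [MeasurableSpace Ω] {μ : Measure Ω} [NeZero μ] {f : Ω → ℝ}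
    (hf : Integrable (fun x => Real.exp (f x)) μ) (c : ℝ) :
    μ.tilted (fun x => f x + c) = μ.tilted f := by
  have := isProbabilityMeasure_tilted hf
  exact (tilted_tilted hf fun _ => c).symm.trans (tilted_const _ c)

variable {d n : ℕ} {𝒳 : Set (EuclideanSpace ℝ (Fin d))} {𝒴 : Set ℝ} {lam gam δ : ℝ}

/-- The covariates of a data set as vectors, the rows of `design z`. -/
def covariate (z : Dataset 𝒳 𝒴 n) (i : Fin n) : EuclideanSpace ℝ (Fin d) := (z i).1

/-- The operator `Xᵀ X + lam I` of ridge regression. -/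
def ridgeGram (lam : ℝ) (z : Dataset 𝒳 𝒴 n) :
    EuclideanSpace ℝ (Fin d) →L[ℝ] EuclideanSpace ℝ (Fin d) :=
  regularizedGram lam Finset.univ (covariate z)

lemma localLipschitz_nonneg (lam : ℝ) (z : Dataset 𝒳 𝒴 n) : 0 ≤ localLipschitz lam z :=
  mul_nonneg (radius_nonneg 𝒳)
    (add_nonneg (mul_nonneg (radius_nonneg 𝒳) (norm_nonneg _)) (radius_nonneg 𝒴))

lemma design_mulVec_apply (z : Dataset 𝒳 𝒴 n) (u : EuclideanSpace ℝ (Fin d)) (i : Fin n) :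
    (design z *ᵥ u.ofLp) i = ⟪covariate z i, u⟫ := by
  simp [design, covariate, Matrix.mulVec, dotProduct, PiLp.inner_apply, mul_comm]

lemma transpose_design_mulVec (z : Dataset 𝒳 𝒴 n) (v : Fin n → ℝ) :
    (design z)ᵀ *ᵥ v = (∑ i, v i • covariate z i).ofLp := by
  ext k
  simp [design, covariate, Matrix.mulVec, dotProduct, mul_comm]

lemma ofLp_ridgeGram_apply (lam : ℝ) (z : Dataset 𝒳 𝒴 n) (u : EuclideanSpace ℝ (Fin d)) :
    (ridgeGram lam z u).ofLp
      = ((design z)ᵀ * design z + lam • (1 : Matrix (Fin d) (Fin d) ℝ)) *ᵥ u.ofLp := by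
  simp only [Matrix.add_mulVec, ← Matrix.mulVec_mulVec, transpose_design_mulVec, Matrix.smul_mulVec,
    Matrix.one_mulVec, ridgeGram, regularizedGram_apply, design_mulVec_apply, WithLp.ofLp_add,
    WithLp.ofLp_smul]

lemma ridgeGram_ridge (hlam : 0 < lam) (z : Dataset 𝒳 𝒴 n) :
    ridgeGram lam z (ridge lam z) = ∑ i, response z i • covariate z i := by
  have hpos : ((design z)ᵀ * design z + lam • (1 : Matrix (Fin d) (Fin d) ℝ)).PosDef := by
    refine Matrix.PosDef.posSemidef_add ?_ (Matrix.PosDef.one.smul hlam)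
    simpa using Matrix.posSemidef_conjTranspose_mul_self (design z)
  refine WithLp.ofLp_injective 2 ?_
  rw [ofLp_ridgeGram_apply, ridge, Matrix.mulVec_mulVec,
    Matrix.mul_nonsing_inv _ ((Matrix.isUnit_iff_isUnit_det _).1 hpos.isUnit), Matrix.one_mulVec,
    transpose_design_mulVec]

open scoped MatrixOrder in
lemma sInf_spectrum_mul_dotProduct_le {ι : Type*} [Fintype ι] [DecidableEq ι]
    {A : Matrix ι ι ℝ} (hA : A.IsHermitian) (v : ι → ℝ) :
    sInf (spectrum ℝ A) * (v ⬝ᵥ v) ≤ v ⬝ᵥ (A *ᵥ v) := by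
  have hle : algebraMap ℝ (Matrix ι ι ℝ) (sInf (spectrum ℝ A)) ≤ A :=
    algebraMap_le_of_le_spectrum fun _ hμ => csInf_le Matrix.finite_real_spectrum.bddBelow hμ
  have hnonneg := (Matrix.le_iff.1 hle).dotProduct_mulVec_nonneg v
  rw [star_trivial, Algebra.algebraMap_eq_smul_one, Matrix.sub_mulVec, Matrix.smul_mulVec,
    Matrix.one_mulVec, dotProduct_sub, dotProduct_smul, smul_eq_mul] at hnonneg
  exact sub_nonneg.1 hnonneg

lemma lambdaMin_mul_norm_sq_le (z : Dataset 𝒳 𝒴 n) (u : EuclideanSpace ℝ (Fin d)) :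
    lambdaMin z * ‖u‖ ^ 2 ≤ ∑ i, ⟪covariate z i, u⟫ ^ 2 := by
  have hHermitian : ((design z)ᵀ * design z).IsHermitian := by
    simpa using Matrix.isHermitian_conjTranspose_mul_self (design z)
  have hnorm : u.ofLp ⬝ᵥ u.ofLp = ‖u‖ ^ 2 := by
    rw [EuclideanSpace.real_norm_sq_eq]
    simp only [dotProduct, sq]
  have hquad : u.ofLp ⬝ᵥ (((design z)ᵀ * design z) *ᵥ u.ofLp) = ∑ i, ⟪covariate z i, u⟫ ^ 2 := by
    rw [← Matrix.mulVec_mulVec, Matrix.dotProduct_mulVec, Matrix.vecMul_transpose]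
    simp only [dotProduct, design_mulVec_apply, sq]
  rw [← hnorm, ← hquad]
  exact sInf_spectrum_mul_dotProduct_le hHermitian u.ofLp

lemma smul_one_le_smul_ridgeGram (hgam : 0 ≤ gam) (lam : ℝ) (z : Dataset 𝒳 𝒴 n) :
    (gam * lam) • 1 ≤ gam • ridgeGram lam z := by
  refine smul_one_le_smul hgam ?_
  simpa [ridgeGram] using smul_one_le_regularizedGram (lam := lam) (l := 0) (s := Finset.univ)
    (x := covariate z) fun u => by simpa using Finset.sum_nonneg fun i _ => sq_nonneg _

lemma posterior_eq_precisionGaussian (hlam : 0 < lam) (hgam : 0 < gam) (z : Dataset 𝒳 𝒴 n) :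
    posterior lam gam z = precisionGaussian (gam • ridgeGram lam z) (ridge lam z) := by
  have hint := integrable_exp_neg_quadratic_sub (mul_pos hgam hlam)
    (smul_one_le_smul_ridgeGram hgam.le lam z) (ridge lam z)
  rw [posterior, precisionGaussian, ← tilted_add_const hint (-(gam / 2)
    * (∑ i, response z i ^ 2 - ⟪ridgeGram lam z (ridge lam z), ridge lam z⟫))]
  congr 1
  ext θ
  have hsquare := sum_sq_residual_add_eq (ridgeGram_ridge hlam z) θ
  simp only [loss, design_mulVec_apply, smul_apply, real_inner_smul_left]
  rw [ridgeGram]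
  linear_combination (-(gam / 2)) * hsquare

lemma isProbabilityMeasure_posterior (hlam : 0 < lam) (hgam : 0 < gam) (z : Dataset 𝒳 𝒴 n) :
    IsProbabilityMeasure (posterior lam gam z) := by
  rw [posterior_eq_precisionGaussian hlam hgam]
  exact isProbabilityMeasure_precisionGaussian (mul_pos hgam hlam)
    (smul_one_le_smul_ridgeGram hgam.le lam z) _

lemma eqOn_covariate_erase {z z' : Dataset 𝒳 𝒴 n} {i : Fin n} (hzz' : ∀ j, j ≠ i → z j = z' j) :
    Set.EqOn (covariate z) (covariate z') (Finset.univ.erase i) := fun j hj => by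
  rw [covariate, covariate, hzz' j (Finset.ne_of_mem_erase hj)]

lemma eqOn_response_erase {z z' : Dataset 𝒳 𝒴 n} {i : Fin n} (hzz' : ∀ j, j ≠ i → z j = z' j) :
    Set.EqOn (response z) (response z') (Finset.univ.erase i) := fun j hj => by
  rw [response, response, hzz' j (Finset.ne_of_mem_erase hj)]

lemma norm_ridgeGram_sub_le (h𝒳 : Bornology.IsBounded 𝒳) (h𝒴 : Bornology.IsBounded 𝒴)
    (hlam : 0 < lam) {z z' : Dataset 𝒳 𝒴 n} {i : Fin n} (hzz' : ∀ j, j ≠ i → z j = z' j) :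
    ‖ridgeGram lam z' (ridge lam z' - ridge lam z)‖ ≤ 2 * localLipschitz lam z := by
  have hresidual (w : Dataset 𝒳 𝒴 n) :
      ‖(response w i - ⟪covariate w i, ridge lam z⟫) • covariate w i‖ ≤ localLipschitz lam z :=
    norm_residual_smul_le (norm_le_radius h𝒳 (w i).1.2) (norm_le_radius h𝒴 (w i).2.2) _
  have hsub := regularizedGram_sub_eq_of_eqOn_erase (Finset.mem_univ i)
    (eqOn_covariate_erase hzz') (eqOn_response_erase hzz') (ridgeGram_ridge hlam z)
    (ridgeGram_ridge hlam z')
  rw [ridgeGram, hsub, two_mul]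
  exact (norm_sub_le _ _).trans (add_le_add (hresidual z') (hresidual z))

lemma indistinguishable_posterior (h𝒳 : Bornology.IsBounded 𝒳) (h𝒴 : Bornology.IsBounded 𝒴)
    (hlam : 0 < lam) (hgam : 0 < gam) (hδ : 0 < δ) (hδ3 : δ ≤ 3) {z z' : Dataset 𝒳 𝒴 n}
    {i : Fin n} (hzz' : ∀ j, j ≠ i → z j = z' j) :
    Indistinguishable
      (ENNReal.ofReal (Real.exp
        (explicitBound lam gam (radius 𝒳) δ (lambdaMin z) (localLipschitz lam z))))
      (ENNReal.ofReal δ) (posterior lam gam z) (posterior lam gam z') := by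
  have hcovariate (w : Dataset 𝒳 𝒴 n) : ‖covariate w i‖ ≤ radius 𝒳 :=
    norm_le_radius h𝒳 (w i).1.2
  have hgram (w : Dataset 𝒳 𝒴 n) := regularizedGram_erase_add_rankOne lam (Finset.mem_univ i)
    (covariate w)
  have hshift := norm_ridgeGram_sub_le h𝒳 h𝒴 hlam hzz'
  rw [posterior_eq_precisionGaussian hlam hgam, posterior_eq_precisionGaussian hlam hgam]
  have herase := regularizedGram_congr lam (eqOn_covariate_erase hzz')
  simp only [ridgeGram, ← hgram, ← herase] at hshift ⊢
  exact indistinguishable_precisionGaussian_explicitBound hlam hgam hδ hδ3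
    (smul_one_le_regularizedGram_erase (Finset.mem_univ i) (hcovariate z)
      (lambdaMin_mul_norm_sq_le z)) (hcovariate z) (hcovariate z') hshift

theorem posterior_isDataDependentDP (h𝒳 : Bornology.IsBounded 𝒳) (h𝒴 : Bornology.IsBounded 𝒴)
    (hlam : 0 < lam) (hgam : 0 < gam) (hδ : 0 < δ) (z : Dataset 𝒳 𝒴 n) :
    IsDataDependentDP (posterior lam gam) z
      (explicitBound lam gam (radius 𝒳) δ (lambdaMin z) (localLipschitz lam z)) δ := by
  intro z' hzz'
  suffices hindist : Indistinguishable (ENNReal.ofReal (Real.exp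
      (explicitBound lam gam (radius 𝒳) δ (lambdaMin z) (localLipschitz lam z))))
      (ENNReal.ofReal δ) (posterior lam gam z) (posterior lam gam z') from
    fun S hS => ⟨hindist.1 S hS, hindist.2 S hS⟩
  rcases eq_or_ne z z' with rfl | hne
  · have hfactor := ENNReal.one_le_ofReal.2 (Real.one_le_exp
      (explicitBound_nonneg (gam := gam) (B := radius 𝒳) (δ := δ) (l := lambdaMin z) hlam
        (localLipschitz_nonneg lam z)))
    exact ⟨.refl hfactor _ _, .refl hfactor _ _⟩
  rcases le_total 1 δ with hδ1 | hδ1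
  · have := isProbabilityMeasure_posterior hlam hgam z
    have := isProbabilityMeasure_posterior hlam hgam z'
    have hδ1' := ENNReal.one_le_ofReal.2 hδ1
    exact ⟨approxLE_of_one_le hδ1', approxLE_of_one_le hδ1'⟩
  · obtain ⟨i, hi⟩ := hzz'.exists_forall_ne_eq hne
    exact indistinguishable_posterior h𝒳 h𝒴 hlam hgam hδ (by linarith) hi

end Posterior

end OPSPTR

end

open OPSPTR in
theorem mainTheorem3_general {d n : ℕ} {Ω : Type*} [MeasurableSpace Ω]
    {𝒳 : Set (EuclideanSpace ℝ (Fin d))} {𝒴 : Set ℝ} (h𝒳 : Bornology.IsBounded 𝒳)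
    (h𝒴 : Bornology.IsBounded 𝒴) {lam gam : ℝ} (hlam : 0 < lam) (hgam : 0 < gam)
    {ε δ εhat δhat : ℝ} (hδ : 0 ≤ δ) (hεhat : 0 ≤ εhat) (hδhat : 0 < δhat)
    {R : Dataset 𝒳 𝒴 n → Measure Ω} (hR : IsDP R ε (δ / 2)) :
    (∀ η : Dataset 𝒳 𝒴 n → ℝ, (∀ z, IsDataDependentDP (posterior lam gam) z (η z) δhat) →
      ∀ epsP : Ω → ℝ, Measurable epsP →
      (∀ z, ENNReal.ofReal (1 - δ / 2) ≤ R z {r | η z ≤ epsP r}) →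
      IsDP (proposeTestRelease R (posterior lam gam) epsP εhat) (ε + εhat) (δ + δhat)) ∧
    (∀ l L : Ω → ℝ, Measurable l → Measurable L →
      (∀ z, ENNReal.ofReal (1 - δ / 2)
        ≤ R z {r | l r ≤ lambdaMin z ∧ localLipschitz lam z ≤ L r}) →
      IsDP (proposeTestRelease R (posterior lam gam)
          (fun r => explicitBound lam gam (radius 𝒳) δhat (l r) (L r)) εhat)
        (ε + εhat) (δ + δhat)) := by
  have hptr {η : Dataset 𝒳 𝒴 n → ℝ} (hη : ∀ z, IsDataDependentDP (posterior lam gam) z (η z) δhat)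
      {epsP : Ω → ℝ} :=
    proposeTestRelease_isDP (epsP := epsP) hδ hεhat hδhat.le hR
      (isProbabilityMeasure_posterior hlam hgam) hη
  refine ⟨fun η hη epsP => hptr hη, fun l L hl hL hconf => ?_⟩
  refine hptr (posterior_isDataDependentDP h𝒳 h𝒴 hlam hgam hδhat)
    (measurable_explicitBound lam gam _ δhat hl hL) fun z => ?_
  refine (hconf z).trans (measure_mono fun r hr => ?_)
  exact explicitBound_mono hlam hgam.le hr.1 (localLipschitz_nonneg lam z) hr.2

theorem mainTheorem3 {d n : ℕ} (𝒳 : Set (EuclideanSpace ℝ (Fin d))) (𝒴 : Set ℝ)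
    (h𝒳 : Bornology.IsBounded 𝒳) (h𝒴 : Bornology.IsBounded 𝒴)
    (lam gam : ℝ) (hlam : 0 < lam) (hgam : 0 < gam)
    (ε δ εhat δhat : ℝ) (hε : 0 ≤ ε) (hδ : 0 ≤ δ) (hεhat : 0 ≤ εhat) (hδhat : 0 < δhat)
    (R : OPSPTR.Dataset 𝒳 𝒴 n → MeasureTheory.Measure (ℝ × ℝ × ℝ))
    (hR : OPSPTR.IsDP R ε (δ / 2)) :
    -- an arbitrary data-dependent privacy bound `e` of the posterior sampler, as a function of
    -- `λ_min`, `‖θ‖` and `L`, with a sanitized upper bound `epsP` computed from the release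
    (∀ e : ℝ → ℝ → ℝ → ℝ,
      (∀ z : OPSPTR.Dataset 𝒳 𝒴 n,
        OPSPTR.IsDataDependentDP (OPSPTR.posterior (𝒳 := 𝒳) (𝒴 := 𝒴) (n := n) lam gam) z
          (e (OPSPTR.lambdaMin z) ‖OPSPTR.ridge lam z‖ (OPSPTR.localLipschitz lam z)) δhat) →
      ∀ epsP : ℝ × ℝ × ℝ → ℝ, Measurable epsP →
      (∀ z : OPSPTR.Dataset 𝒳 𝒴 n,
        ENNReal.ofReal (1 - δ / 2) ≤
          R z {r | e (OPSPTR.lambdaMin z) ‖OPSPTR.ridge lam z‖ (OPSPTR.localLipschitz lam z)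
            ≤ epsP r}) →
      OPSPTR.IsDP (OPSPTR.opsPTR lam gam R epsP εhat) (ε + εhat) (δ + δhat)) ∧
    -- the explicit bound, evaluated at confidence bounds `conf r` for the three statistics
    (∀ conf : ℝ × ℝ × ℝ → ℝ × ℝ × ℝ, Measurable conf →
      (∀ z : OPSPTR.Dataset 𝒳 𝒴 n,
        ENNReal.ofReal (1 - δ / 2) ≤
          R z {r | (conf r).1 ≤ OPSPTR.lambdaMin z ∧ ‖OPSPTR.ridge lam z‖ ≤ (conf r).2.1 ∧
            OPSPTR.localLipschitz lam z ≤ (conf r).2.2}) →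
      OPSPTR.IsDP
        (OPSPTR.opsPTR lam gam R
          (fun r => OPSPTR.explicitBound lam gam (OPSPTR.radius 𝒳) δhat (conf r).1 (conf r).2.2)
          εhat)
        (ε + εhat) (δ + δhat)) := by
  obtain ⟨hgeneral, hexplicit⟩ := mainTheorem3_general h𝒳 h𝒴 hlam hgam hδ hεhat hδhat hR
  exact ⟨fun e he epsP => hgeneral _ he epsP, fun conf hc hconf =>
    hexplicit _ _ hc.fst hc.snd.snd fun z =>
      (hconf z).trans (measure_mono fun r hr => ⟨hr.1, hr.2.2⟩)⟩
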